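/- Localization game. Let $G$ be a finite graph. A robber occupies a vertex of $G$ unknown to a cop. In each round the cop chooses a set $W$ of at most $k$ vertices and is told, for every $w\in W$, the graph distance from $w$ to the robber's current position. If this answer, together with all earlier answers, determines the robber's current position, the cop wins. Otherwise the robber moves to a neighbouring vertex (he remains where he is if he has no neighbour) and the next round begins; the cop's choice of $W$ may depend on all earlier answers. The localization number $\zeta(G)$ is the least $k$ for which the cop has a strategy that locates the robber after finitely many rounds, whatever the robber does. The statement below holds both for this version of the game and for the version in which the robber may also remain at his vertex instead of moving. Let $G_{n,p}$ denote the binomial random graph on $n$ vertices in which every edge is present independently with probability $p$. **Corollary.** Let $0<\alpha<1/2$ be a constant and let $p=p(n)=1/n^{\alpha}$. Then, asymptotically almost surely, $$(1-2\alpha)\,n^{\alpha}\log n\;\lesssim\;\zeta(G_{n,p})\;\lesssim\;\begin{cases}(1-\alpha)\,n^{\alpha}\log n & \text{if } 0<\alpha<\tfrac13,\\[2pt] \dfrac{1+\alpha}{2}\,n^{\alpha}\log n & \text{if } \tfrac13\le\alpha<\tfrac12.\end{cases}$$ Here $A_n\lesssim B_n$ means $A_n\le(1+o(1))B_n$. That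 is, writing $U_n$ for the expression on the right, there is a sequence of real numbers $\delta_n\to0$ (depending on $\alpha$) such that the probability that both $(1-2\alpha)n^{\alpha}\log n\le(1+\delta_n)\,\zeta(G_{n,p})$ and $\zeta(G_{n,p})\le(1+\delta_n)\,U_n$ hold tends to $1$ as $n\to\infty$. -/

import Mathlib

open Filter Topology SimpleGraph

namespace LocalizationGame

/-- The two usual conventions for the robber's move after an unsuccessful round: he has to go to
a neighbouring vertex, or he may also remain where he is. -/
inductive RobberRule
  | mustMove
  | mayStay

variable {V : Type*}

/-- `CanStep G r u v`: under the convention `r` a robber at `u` can be at `v` in the next round.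
(A robber on an isolated vertex has nowhere to go and remains there under both conventions.) -/
def CanStep (G : SimpleGraph V) (r : RobberRule) (u v : V) : Prop :=
  G.Adj u v ∨ (u = v ∧ (r = RobberRule.mayStay ∨ ∀ w, ¬ G.Adj u w))

/-- The vertices of `A` with the same `W`-signature as `v`, where the `W`-signature of a vertex is
the family of its graph distances from the vertices of `W` (infinite between components). -/
def sameSignature (G : SimpleGraph V) (A : Set V) (W : Finset V) (v : V) : Set V :=
  {u | u ∈ A ∧ ∀ w ∈ W, G.edist u w = G.edist v w}

/-- The possible positions of the robber after his move, if he was somewhere in `B`. -/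
def afterMove (G : SimpleGraph V) (r : RobberRule) (B : Set V) : Set V :=
  {v | ∃ u ∈ B, CanStep G r u v}

/-- `CopWinsWithin G r k m A`: a cop who knows exactly that the robber is in `A` can be sure to
determine the robber's position within `m` rounds, asking in each round for the distances from a
set `W` of at most `k` vertices. For every position `v` of the robber, the answer
leaves `sameSignature G A W v` as the set of possible positions; either this is `{v}` and the
robber is located, or the robber moves and the game goes on. The choice of the next `W` may
depend on all answers so far. -/
def CopWinsWithin (G : SimpleGraph V) (r : RobberRule) (k : ℕ) : ℕ → Set V → Prop
  | 0, _ => False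
  | m + 1, A => ∃ W : Finset V, W.card ≤ k ∧ ∀ v ∈ A,
      sameSignature G A W v = {v} ∨
        CopWinsWithin G r k m (afterMove G r (sameSignature G A W v))

/-- The localization number: the least `k` for which the cop, who has no information on the
robber's initial position, can be sure to locate him after finitely many rounds. -/
noncomputable def localizationNumber (G : SimpleGraph V) (r : RobberRule) : ℕ :=
  sInf {k : ℕ | ∃ m : ℕ, CopWinsWithin G r k m Set.univ}

/-- The property `P` of graphs on `n` vertices holds asymptotically almost surely for the binomial
random graph with edge probability `p n`. -/
def Aas (p : ℕ → unitInterval) (P : ∀ n : ℕ, SimpleGraph (Fin n) → Prop) : Prop :=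
  Tendsto (fun n : ℕ => binomialRandom (Fin n) (p n) {G | P n G}) atTop (𝓝 1)

end LocalizationGame

/-!
For `α < 1 / 2` the random graph has diameter at most two, so that an answer to the cop tells
essentially which of the queried vertices are adjacent to the robber.

*Lower bound.* Let `W` be a query set of size `k ≤ θ n ^ α log n` with `θ < 1 - 2 α`. A vertex `v`
has on average about `n p (1 - p) ^ k ≥ n ^ β` neighbours, `β > α`, that avoid `W` and are adjacent
to no vertex of `W` except possibly `v`. By a Chernoff bound and a union bound over
`exp (O(n ^ α (log n) ^ 2))` sets `W`, every `v` has at least two of them, for every `W`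
(`aas_escape`). All of them give the same answer, so a robber who always moves to such a
neighbour keeps the cop from learning more than a whole neighbourhood (`not_copWinsWithin`).

*Upper bound.* Two vertices are distinguished by every vertex adjacent to exactly one of them, and
there are `(2 - o(1)) p n` of those (`aas_private_neighbors`). If the cop knows that the robber is
in `A` and queries `k = (1 + ε) (1 - α) n ^ α log n` random vertices, each pair of candidates stays
unresolved with probability at most about `exp (-2 p k) = n ^ (-2 (1 + ε) (1 - α))`. Hence some
choice of the query set leaves only classes of `s = 1` or `s ≤ |A| n ^ (-(1 + ε') (1 - α))`
candidates. The robber's move multiplies the number of candidates by `O(n ^ (1 - α))` only, so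
this number decreases until the robber is located (`localizationNumber_le`). This gives the
constant `1 - α` in the whole range `0 < α < 1 / 2`, and `1 - α ≤ (1 + α) / 2` for `1 / 3 ≤ α`.

All probabilistic estimates concern numbers of vertices `u ∈ S` that are adjacent to all of `A` and
to none of `B`, for disjoint `A`, `B`, `S`. These are binomial, and their moment generating function
is computed in `integral_pow_card_starSet`. Both bounds hold for each fixed `ε`, and
`exists_tendsto_zero_aas` lets `ε` tend to zero with `n`.
-/

namespace LocalizationGame

/-! ### The two strategies on a fixed graph -/

/-- If a robber at any vertex `v` can always move to at least two neighbours that receive the same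
answer, then knowing the whole neighbourhood of the robber's previous position as candidates never
suffices for the cop. The answer is the same for two neighbours outside `W` that are not
adjacent to `W \ {v}`: the distance to `v` is one, all others are two. -/
lemma not_copWinsWithin {V : Type*} [DecidableEq V] {G : SimpleGraph V} {r : RobberRule} {k : ℕ}
    (hdiam : ∀ x y, x ≠ y → ∃ z, G.Adj z x ∧ G.Adj z y)
    (hesc : ∀ (W : Finset V), W.card ≤ k → ∀ v, ∃ u₁ u₂, u₁ ≠ u₂ ∧
      ∀ u, u = u₁ ∨ u = u₂ → G.Adj u v ∧ u ∉ W ∧ ∀ w ∈ W, w ≠ v → ¬ G.Adj u w) (m : ℕ) :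
    ∀ (A : Set V) (v : V), (∀ u, G.Adj v u → u ∈ A) → ¬ CopWinsWithin G r k m A := by
  induction m with
  | zero => intro A v _ h; exact h
  | succ m ih =>
    rintro A v hA ⟨W, hW, hwin⟩
    obtain ⟨u₁, u₂, hne, hu⟩ := hesc W hW v
    have hdist : ∀ u, u = u₁ ∨ u = u₂ → ∀ w ∈ W, G.edist u w = if w = v then 1 else 2 := by
      intro u hu' w hw
      obtain ⟨h1, h2, h3⟩ := hu u hu'
      split_ifs with hwv
      · rw [hwv, edist_eq_one_iff_adj]; exact h1
      · have huw : u ≠ w := fun h => h2 (h ▸ hw)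
        rw [edist_eq_two_iff]
        obtain ⟨z, hz1, hz2⟩ := hdiam u w huw
        exact ⟨huw, h3 w hw hwv, z, hz1.symm, hz2.symm⟩
    have hmem : u₁ ∈ sameSignature G A W u₁ := ⟨hA _ (hu u₁ (.inl rfl)).1.symm, fun _ _ => rfl⟩
    have hmem' : u₂ ∈ sameSignature G A W u₁ :=
      ⟨hA _ (hu u₂ (.inr rfl)).1.symm, fun w hw => by
        rw [hdist u₁ (.inl rfl) w hw, hdist u₂ (.inr rfl) w hw]⟩
    rcases hwin u₁ hmem.1 with h | h
    · rw [h] at hmem'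
      exact hne hmem'.symm
    · refine ih _ u₁ ?_ h
      exact fun u hadj => ⟨u₁, hmem, .inl hadj⟩

lemma lt_localizationNumber {V : Type*} [Fintype V] [Nonempty V] [DecidableEq V]
    {G : SimpleGraph V} {r : RobberRule} {k : ℕ}
    (hdiam : ∀ x y, x ≠ y → ∃ z, G.Adj z x ∧ G.Adj z y)
    (hesc : ∀ (W : Finset V), W.card ≤ k → ∀ v, ∃ u₁ u₂, u₁ ≠ u₂ ∧
      ∀ u, u = u₁ ∨ u = u₂ → G.Adj u v ∧ u ∉ W ∧ ∀ w ∈ W, w ≠ v → ¬ G.Adj u w) :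
    k < localizationNumber G r := by
  have hne : {k : ℕ | ∃ m : ℕ, CopWinsWithin G r k m Set.univ}.Nonempty := by
    refine ⟨Fintype.card V, 1, Finset.univ, le_rfl, fun v _ => .inl ?_⟩
    ext u
    refine ⟨fun h => ?_, fun h => ⟨Set.mem_univ _, fun w _ => by rw [Set.mem_singleton_iff.1 h]⟩⟩
    have := h.2 v (Finset.mem_univ v)
    rwa [edist_self, edist_eq_zero_iff] at this
  by_contra! hle
  obtain ⟨m, hm⟩ := Nat.sInf_mem hne
  exact not_copWinsWithin hdiam (fun W hW => hesc W (hW.trans hle)) m Set.univ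
    (Classical.arbitrary V) (fun _ _ => Set.mem_univ _) hm

/-- The cop wins as soon as he can always make the set of candidates shrink. -/
lemma copWinsWithin_of_shrinking {V : Type*} {G : SimpleGraph V} {r : RobberRule}
    {k : ℕ} (h : ∀ A : Set V, ∃ W : Finset V, W.card ≤ k ∧ ∀ v ∈ A, sameSignature G A W v = {v} ∨
      (afterMove G r (sameSignature G A W v)).ncard < A.ncard) (N : ℕ) :
    ∀ A : Set V, A.ncard < N → CopWinsWithin G r k N A := by
  induction N with
  | zero => intro A hA; exact absurd hA (Nat.not_lt_zero _)
  | succ N ih =>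
    intro A hA
    obtain ⟨W, hW, hv⟩ := h A
    exact ⟨W, hW, fun v hvA => (hv v hvA).imp_right fun hlt => ih _ (by omega)⟩

lemma ncard_afterMove_le {V : Type*} [Fintype V] [DecidableEq V] {G : SimpleGraph V}
    [DecidableRel G.Adj] {r : RobberRule} {Δ : ℕ} (hΔ : ∀ v, G.degree v ≤ Δ) (B : Set V) :
    (afterMove G r B).ncard ≤ B.ncard * (Δ + 1) := by
  classical
  have hsub : afterMove G r B ⊆
      ↑(B.toFinset.biUnion fun u => insert u (G.neighborFinset u)) := by
    rintro v ⟨u, hu, h⟩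
    simp only [Finset.coe_biUnion, Set.mem_iUnion]
    refine ⟨u, by simpa using hu, ?_⟩
    rcases h with h | ⟨h, _⟩
    · simp [h]
    · simp [h]
  calc (afterMove G r B).ncard ≤ _ := Set.ncard_le_ncard hsub (Finset.finite_toSet _)
    _ = (B.toFinset.biUnion fun u => insert u (G.neighborFinset u)).card := Set.ncard_coe_finset _
    _ ≤ B.toFinset.card * (Δ + 1) := by
        refine Finset.card_biUnion_le_card_mul _ _ _ fun u _ => ?_
        exact (Finset.card_insert_le _ _).trans (Nat.succ_le_succ (by simpa using hΔ u))
    _ = B.ncard * (Δ + 1) := by rw [Set.ncard_eq_toFinset_card']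

/-- First-moment argument over `k` independent uniform query vertices: if every pair of vertices is
left unresolved by at most a proportion `ρ` of all vertices, then some set of at most `k` vertices
leaves at most `|A|² ρ ^ k` pairs from `A` unresolved. -/
lemma exists_few_unresolved {V : Type*} [Fintype V] [Nonempty V] [DecidableEq V]
    (G : SimpleGraph V) {ρ : ℝ} (hρ₀ : 0 ≤ ρ) (hρ : ∀ x y : V, x ≠ y →
      ((Finset.univ.filter fun w => G.edist x w = G.edist y w).card : ℝ) ≤ ρ * Fintype.card V)
    (k : ℕ) (A : Finset V) :
    ∃ W : Finset V, W.card ≤ k ∧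
      (((A ×ˢ A).filter fun z => z.1 ≠ z.2 ∧ ∀ w ∈ W, G.edist z.1 w = G.edist z.2 w).card : ℝ)
        ≤ (A.card : ℝ) ^ 2 * ρ ^ k := by
  classical
  set n := Fintype.card V with hn
  let X : (Fin k → V) → ℝ := fun f => ∑ z ∈ A ×ˢ A,
    if z.1 ≠ z.2 ∧ ∀ i, G.edist z.1 (f i) = G.edist z.2 (f i) then 1 else 0
  have hsum : ∑ f, X f ≤ ∑ _f : Fin k → V, (A.card : ℝ) ^ 2 * ρ ^ k := by
    rw [Finset.sum_comm]
    calc _ ≤ ∑ z ∈ A ×ˢ A, (ρ * n) ^ k := by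
          refine Finset.sum_le_sum fun z _ => ?_
          by_cases hz : z.1 = z.2
          · have : 0 ≤ ρ * n := by positivity
            simpa [hz] using pow_nonneg this k
          · have hset : (Finset.univ.filter fun f : Fin k → V =>
                z.1 ≠ z.2 ∧ ∀ i, G.edist z.1 (f i) = G.edist z.2 (f i)) =
                Fintype.piFinset fun _ => Finset.univ.filter fun w =>
                  G.edist z.1 w = G.edist z.2 w := by
              ext f; simp [hz]
            rw [Finset.sum_boole, hset, Fintype.card_piFinset_const, Nat.cast_pow]
            exact pow_le_pow_left₀ (Nat.cast_nonneg _) (hρ _ _ hz) k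
      _ = _ := by
          simp only [Finset.sum_const, Finset.card_product, nsmul_eq_mul, Finset.card_univ,
            Fintype.card_fun, Fintype.card_fin, ← hn]
          push_cast
          ring
  obtain ⟨f, -, hf⟩ := Finset.exists_le_of_sum_le Finset.univ_nonempty hsum
  refine ⟨Finset.univ.image f, Finset.card_image_le.trans (by simp), ?_⟩
  refine le_trans (le_of_eq ?_) hf
  simp [X, Finset.sum_boole]

/-- If few pairs stay unresolved under a random query set of size `k`, a class of `s ≥ 2` candidates
with the same answer is too small for its neighbourhood to make up for the loss: the class accounts
for `s (s - 1) ≥ s² / 2` unresolved pairs, so `s² ≤ 2 |A|² ρ ^ k`, and after the robber's move there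
are at most `s (Δ + 1) < |A|` candidates. -/
lemma localizationNumber_le {V : Type*} [Fintype V] [Nonempty V] [DecidableEq V]
    {G : SimpleGraph V} [DecidableRel G.Adj] {r : RobberRule} {Δ k : ℕ} {ρ : ℝ} (hρ₀ : 0 ≤ ρ)
    (hΔ : ∀ v, G.degree v ≤ Δ)
    (hρ : ∀ x y : V, x ≠ y →
      ((Finset.univ.filter fun w => G.edist x w = G.edist y w).card : ℝ) ≤ ρ * Fintype.card V)
    (hk : 2 * ρ ^ k * ((Δ : ℝ) + 1) ^ 2 < 1) :
    localizationNumber G r ≤ k := by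
  classical
  refine Nat.sInf_le ⟨Fintype.card V + 1, copWinsWithin_of_shrinking (fun A => ?_) _ _ ?_⟩
  swap
  · rw [Set.ncard_univ, Nat.card_eq_fintype_card]; exact Nat.lt_succ_self _
  obtain ⟨W, hW, hun⟩ := exists_few_unresolved G hρ₀ hρ k A.toFinset
  refine ⟨W, hW, fun v hv => ?_⟩
  set B := sameSignature G A W v with hB
  have hvB : v ∈ B := ⟨hv, fun _ _ => rfl⟩
  by_cases hone : B = {v}
  · exact .inl hone
  right
  refine (ncard_afterMove_le hΔ B).trans_lt ?_
  have hs : 2 ≤ B.ncard := by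
    by_contra! hlt
    refine hone (Set.eq_singleton_iff_unique_mem.2 ⟨hvB, fun x hx => ?_⟩)
    exact (Set.ncard_le_one (Set.toFinite _)).1 (by omega) x hx v hvB
  have hoff : (B.toFinset.offDiag.card : ℝ) ≤ (A.toFinset.card : ℝ) ^ 2 * ρ ^ k := by
    refine le_trans (Nat.cast_le.2 (Finset.card_le_card ?_)) hun
    intro z hz
    simp only [Finset.mem_offDiag, Set.mem_toFinset] at hz
    simp only [Finset.mem_filter, Finset.mem_product, Set.mem_toFinset]
    exact ⟨⟨hz.1.1, hz.2.1.1⟩, hz.2.2, fun w hw => (hz.1.2 w hw).trans (hz.2.1.2 w hw).symm⟩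
  rw [Finset.offDiag_card, ← Set.ncard_eq_toFinset_card', ← Set.ncard_eq_toFinset_card',
    Nat.cast_sub (Nat.le_mul_self _)] at hoff
  push_cast at hoff
  have hs' : (2 : ℝ) ≤ B.ncard := by exact_mod_cast hs
  have hA : (0 : ℝ) < A.ncard := by
    exact_mod_cast (Set.ncard_pos (Set.toFinite _)).2 ⟨v, hv⟩
  have h1 : (B.ncard : ℝ) ^ 2 ≤ 2 * ((A.ncard : ℝ) ^ 2 * ρ ^ k) := by nlinarith
  have h2 : ((B.ncard : ℝ) * (Δ + 1)) ^ 2 < (A.ncard : ℝ) ^ 2 := by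
    calc ((B.ncard : ℝ) * (Δ + 1)) ^ 2 = (B.ncard : ℝ) ^ 2 * ((Δ : ℝ) + 1) ^ 2 := by ring
      _ ≤ 2 * ((A.ncard : ℝ) ^ 2 * ρ ^ k) * ((Δ : ℝ) + 1) ^ 2 := by gcongr
      _ = (A.ncard : ℝ) ^ 2 * (2 * ρ ^ k * ((Δ : ℝ) + 1) ^ 2) := by ring
      _ < (A.ncard : ℝ) ^ 2 * 1 := by gcongr
      _ = _ := mul_one _
  exact_mod_cast lt_of_pow_lt_pow_left₀ 2 hA.le h2

/-! ### Star counts in the binomial random graph -/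

open MeasureTheory unitInterval in
/-- Distinct potential edges are present independently with probability `p`. -/
lemma binomialRandom_real_edges {V : Type*} [Fintype V] [DecidableEq V] (p : I)
    (E F : Finset (Sym2 V)) (hEF : Disjoint E F) (hE : ∀ e ∈ E, ¬ e.IsDiag)
    (hF : ∀ e ∈ F, ¬ e.IsDiag) :
    (binomialRandom V p).real {G | (∀ e ∈ E, e ∈ G.edgeSet) ∧ ∀ e ∈ F, e ∉ G.edgeSet} =
      (p : ℝ) ^ E.card * (1 - p) ^ F.card := by
  have hset : (fun G e ↦ e ∈ G.edgeSet) '' {G : SimpleGraph V |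
      (∀ e ∈ E, e ∈ G.edgeSet) ∧ ∀ e ∈ F, e ∉ G.edgeSet} =
      Set.pi (Finset.univ : Finset (Sym2 V)) (fun e => {q : Prop | (e.IsDiag → ¬ q) ∧
        (e ∈ E → q) ∧ (e ∈ F → ¬ q)}) := by
    ext g
    constructor
    · rintro ⟨G, ⟨h1, h2⟩, rfl⟩ e _
      exact ⟨fun hd h => G.not_isDiag_of_mem_edgeSet h hd, h1 e, h2 e⟩
    · intro h
      have hG : ∀ e, e ∈ (fromEdgeSet {e | g e}).edgeSet ↔ g e := by
        intro e
        rw [edgeSet_fromEdgeSet]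
        exact ⟨fun h => h.1, fun hg => ⟨hg, fun hd => (h e (by simp)).1 hd hg⟩⟩
      refine ⟨fromEdgeSet {e | g e}, ⟨fun e he => ?_, fun e he => ?_⟩, ?_⟩
      · exact (hG e).2 ((h e (by simp)).2.1 he)
      · exact fun hh => (h e (by simp)).2.2 he ((hG e).1 hh)
      · funext e
        exact propext (hG e)
  rw [measureReal_def, binomialRandom_apply, hset,
    Measure.infinitePi_pi _ (fun _ _ => MeasurableSet.of_discrete),
    ENNReal.toReal_prod]
  have key : ∀ e : Sym2 V, ((toNNReal p • Measure.dirac (¬ e.IsDiag) +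
      toNNReal (σ p) • Measure.dirac False : Measure Prop)
        {q : Prop | (e.IsDiag → ¬ q) ∧ (e ∈ E → q) ∧ (e ∈ F → ¬ q)}).toReal =
      (if e ∈ E then (p : ℝ) else 1) * (if e ∈ F then (1 - p : ℝ) else 1) := by
    intro e
    have h3 : ∀ (P : Prop) (T : Set Prop), ((toNNReal p • Measure.dirac P +
        toNNReal (σ p) • Measure.dirac False : Measure Prop) T).toReal =
        p * T.indicator 1 P + (1 - p) * T.indicator 1 False := by
      intro P T
      rw [Measure.add_apply, Measure.smul_apply, Measure.smul_apply,
        Measure.dirac_apply' _ MeasurableSet.of_discrete,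
        Measure.dirac_apply' _ MeasurableSet.of_discrete, ENNReal.smul_def, ENNReal.smul_def,
        smul_eq_mul, smul_eq_mul]
      by_cases hP : P ∈ T <;> by_cases hF : False ∈ T <;>
        simp [hP, hF, ← ENNReal.coe_add]
    rw [h3]
    by_cases h1 : e ∈ E
    · have h2 : e ∉ F := Finset.disjoint_left.1 hEF h1
      simp [h1, h2, hE e h1, Set.indicator]
    · by_cases h2 : e ∈ F
      · simp [h1, h2, hF e h2, Set.indicator]
      · by_cases hd : e.IsDiag <;> simp [h1, h2, hd, Set.indicator]
  simp only [key, Finset.prod_mul_distrib, Finset.prod_ite_mem, Finset.univ_inter,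
    Finset.prod_const]

/-- The vertices of `S` adjacent to all of `A` and to none of `B`. -/
noncomputable def starSet {V : Type*} (G : SimpleGraph V) (A B S : Finset V) : Finset V := by
  classical exact S.filter fun u => (∀ x ∈ A, G.Adj u x) ∧ ∀ y ∈ B, ¬ G.Adj u y

lemma mem_starSet {V : Type*} {G : SimpleGraph V} {A B S : Finset V} {u : V} :
    u ∈ starSet G A B S ↔ u ∈ S ∧ (∀ x ∈ A, G.Adj u x) ∧ ∀ y ∈ B, ¬ G.Adj u y := by
  simp [starSet]

open MeasureTheory unitInterval in
/-- The stars at the vertices of `R` use disjoint sets of edges. -/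
lemma binomialRandom_real_subset_starSet {V : Type*} [Fintype V] [DecidableEq V] (p : I)
    {A B S : Finset V} (hAB : Disjoint A B) (hAS : Disjoint A S) (hBS : Disjoint B S)
    {R : Finset V} (hR : R ⊆ S) :
    (binomialRandom V p).real {G | R ⊆ starSet G A B S} =
      ((p : ℝ) ^ A.card * (1 - p) ^ B.card) ^ R.card := by
  have hinj : ∀ C : Finset V, Disjoint C S →
      Set.InjOn (fun z : V × V => s(z.1, z.2)) (R ×ˢ C : Finset (V × V)) := by
    rintro C hC ⟨a, b⟩ h1 ⟨c, d⟩ h2 h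
    simp only [Finset.coe_product, Set.mem_prod, Finset.mem_coe] at h1 h2
    rcases Sym2.eq_iff.1 h with ⟨h, h'⟩ | ⟨h, h'⟩
    · simp only at h h'; rw [h, h']
    · simp only at h h'
      exact absurd (hR h1.1) (Finset.disjoint_left.1 hC (h ▸ h2.2))
  have hnd : ∀ C : Finset V, Disjoint C S →
      ∀ e ∈ (R ×ˢ C).image (fun z : V × V => s(z.1, z.2)), ¬ e.IsDiag := by
    intro C hC e he
    obtain ⟨⟨a, b⟩, hab, rfl⟩ := Finset.mem_image.1 he
    simp only [Finset.mem_product] at hab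
    rw [Sym2.mk_isDiag_iff]
    intro h
    exact Finset.disjoint_left.1 hC hab.2 (hR ((show a = b from h) ▸ hab.1))
  have hdis : Disjoint ((R ×ˢ A).image (fun z : V × V => s(z.1, z.2)))
      ((R ×ˢ B).image (fun z : V × V => s(z.1, z.2))) := by
    rw [Finset.disjoint_left]
    intro e he he'
    obtain ⟨⟨a, b⟩, hab, rfl⟩ := Finset.mem_image.1 he
    obtain ⟨⟨c, d⟩, hcd, h⟩ := Finset.mem_image.1 he'
    simp only [Finset.mem_product] at hab hcd
    rcases Sym2.eq_iff.1 h with ⟨h, h'⟩ | ⟨h, h'⟩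
    · simp only at h h'
      exact Finset.disjoint_left.1 hAB hab.2 (h' ▸ hcd.2)
    · simp only at h h'
      exact Finset.disjoint_left.1 hAS hab.2 (h ▸ hR hcd.1)
  have := binomialRandom_real_edges p _ _ hdis (hnd A hAS) (hnd B hBS)
  rw [Finset.card_image_of_injOn (hinj A hAS), Finset.card_image_of_injOn (hinj B hBS),
    Finset.card_product, Finset.card_product] at this
  rw [mul_pow, ← pow_mul, ← pow_mul, mul_comm A.card, mul_comm B.card, ← this]
  congr 1
  ext G
  simp only [Set.mem_ofPred_eq, Finset.forall_mem_image, Finset.subset_iff, mem_starSet,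
    Prod.forall, Finset.mem_product, mem_edgeSet]
  constructor
  · exact fun h => ⟨fun a b hab => (h hab.1).2.1 b hab.2, fun a b hab => (h hab.1).2.2 b hab.2⟩
  · exact fun h a ha => ⟨hR ha, fun b hb => h.1 a b ⟨ha, hb⟩, fun b hb => h.2 a b ⟨ha, hb⟩⟩

instance {V : Type*} [Finite V] : MeasurableSingletonClass (SimpleGraph V) where
  measurableSet_singleton G := by
    have : {G} = edgeSet ⁻¹' ({G.edgeSet} : Set (Set (Sym2 V))) := by
      ext H; simp
    rw [this]
    exact measurable_edgeSet (MeasurableSet.singleton _)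

open MeasureTheory unitInterval in
/-- The number of vertices in `starSet G A B S` has the moment generating function of the binomial
distribution: expand `t ^ X = ∑ (t - 1) ^ |R|` over the subsets `R` of the star set. -/
lemma integral_pow_card_starSet {V : Type*} [Fintype V] [DecidableEq V] (p : I)
    {A B S : Finset V} (hAB : Disjoint A B) (hAS : Disjoint A S) (hBS : Disjoint B S) (t : ℝ) :
    ∫ G, t ^ (starSet G A B S).card ∂(binomialRandom V p) =
      (1 + (t - 1) * ((p : ℝ) ^ A.card * (1 - p) ^ B.card)) ^ S.card := by
  classical
  have hexp : ∀ G : SimpleGraph V, t ^ (starSet G A B S).card = ∑ R ∈ S.powerset,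
      {G : SimpleGraph V | R ⊆ starSet G A B S}.indicator (fun _ => (t - 1) ^ R.card) G := by
    intro G
    have h1 : t ^ (starSet G A B S).card = ∏ _u ∈ starSet G A B S, (1 + (t - 1)) := by simp
    have h2 : starSet G A B S ⊆ S := fun u hu => (mem_starSet.1 hu).1
    rw [h1, Finset.prod_one_add]
    simp only [Finset.prod_const]
    rw [← Finset.sum_subset (Finset.powerset_mono.2 h2)]
    · refine Finset.sum_congr rfl fun R hR => ?_
      rw [Set.indicator_of_mem (show G ∈ {G : SimpleGraph V | R ⊆ starSet G A B S} from
        Finset.mem_powerset.1 hR)]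
    · intro R _ hR
      exact Set.indicator_of_notMem (fun h => hR (Finset.mem_powerset.2 h)) _
  simp only [hexp]
  rw [integral_finsetSum _ fun R _ => Integrable.of_finite]
  have : ∀ R ∈ S.powerset, ∫ G, {G : SimpleGraph V | R ⊆ starSet G A B S}.indicator
      (fun _ => (t - 1) ^ R.card) G ∂(binomialRandom V p) =
      ∏ _u ∈ R, ((t - 1) * ((p : ℝ) ^ A.card * (1 - p) ^ B.card)) := by
    intro R hR
    rw [integral_indicator_const _ (Set.toFinite _).measurableSet,
      binomialRandom_real_subset_starSet p hAB hAS hBS (Finset.mem_powerset.1 hR)]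
    simp [mul_pow, mul_comm]
  rw [Finset.sum_congr rfl this, ← Finset.prod_one_add, Finset.prod_const]

open MeasureTheory unitInterval in
lemma binomialRandom_real_le_pow_card_starSet {V : Type*} [Fintype V] [DecidableEq V] (p : I)
    {A B S : Finset V} (hAB : Disjoint A B) (hAS : Disjoint A S) (hBS : Disjoint B S) {t c : ℝ}
    (ht : 0 ≤ t) (hc : 0 < c) :
    (binomialRandom V p).real {G | c ≤ t ^ (starSet G A B S).card} ≤
      c⁻¹ * Real.exp ((t - 1) * ((p : ℝ) ^ A.card * (1 - p) ^ B.card) * S.card) := by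
  have h := mul_meas_ge_le_integral_of_nonneg (μ := binomialRandom V p)
    (f := fun G => t ^ (starSet G A B S).card) (.of_forall fun G => pow_nonneg ht _)
    Integrable.of_finite c
  rw [integral_pow_card_starSet p hAB hAS hBS] at h
  rw [inv_mul_eq_div, le_div_iff₀' hc]
  refine h.trans ?_
  have hp0 : (0 : ℝ) ≤ p := p.2.1
  have hp1 : (0 : ℝ) ≤ 1 - p := sub_nonneg.2 p.2.2
  have hq0 : (0 : ℝ) ≤ (p : ℝ) ^ A.card * (1 - p) ^ B.card := by positivity
  have hq1 : (p : ℝ) ^ A.card * (1 - p) ^ B.card ≤ 1 :=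
    mul_le_one₀ (pow_le_one₀ hp0 p.2.2) (by positivity) (pow_le_one₀ hp1 (by linarith))
  rw [mul_comm _ (S.card : ℝ), Real.exp_nat_mul]
  refine pow_le_pow_left₀ (by nlinarith) ?_ _
  linarith [Real.add_one_le_exp ((t - 1) * ((p : ℝ) ^ A.card * (1 - p) ^ B.card))]

open MeasureTheory unitInterval in
/-- Chernoff bound for the lower tail. -/
lemma binomialRandom_real_card_starSet_le {V : Type*} [Fintype V] [DecidableEq V] (p : I)
    {A B S : Finset V} (hAB : Disjoint A B) (hAS : Disjoint A S) (hBS : Disjoint B S) {s x q : ℝ}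
    (hs : 0 ≤ s) (hq : q ≤ (p : ℝ) ^ A.card * (1 - p) ^ B.card * S.card) :
    (binomialRandom V p).real {G | ((starSet G A B S).card : ℝ) ≤ x} ≤
      Real.exp (s * x - s / (1 + s) * q) := by
  have h := binomialRandom_real_le_pow_card_starSet p hAB hAS hBS (Real.exp_pos (-s)).le
    (Real.exp_pos (-(s * x)))
  have hsub : {G : SimpleGraph V | ((starSet G A B S).card : ℝ) ≤ x} ⊆
      {G | Real.exp (-(s * x)) ≤ Real.exp (-s) ^ (starSet G A B S).card} := by
    intro G hG
    rw [Set.mem_ofPred_eq] at hG ⊢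
    rw [← Real.exp_nat_mul]
    exact Real.exp_le_exp.2 (by nlinarith)
  refine (measureReal_mono hsub).trans (h.trans ?_)
  rw [← Real.exp_neg, neg_neg, ← Real.exp_add]
  refine Real.exp_le_exp.2 ?_
  have hp0 : (0 : ℝ) ≤ p := p.2.1
  have hp1 : (0 : ℝ) ≤ 1 - p := sub_nonneg.2 p.2.2
  have h1 : Real.exp (-s) - 1 ≤ - (s / (1 + s)) := by
    have : Real.exp (-s) ≤ 1 / (1 + s) := by
      rw [Real.exp_neg, ← one_div]
      exact one_div_le_one_div_of_le (by linarith) (by linarith [Real.add_one_le_exp s])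
    have h2 : 1 / (1 + s) = 1 - s / (1 + s) := by field_simp; ring
    linarith
  have h2 : 0 ≤ s / (1 + s) := by positivity
  have h3 : (0 : ℝ) ≤ (p : ℝ) ^ A.card * (1 - p) ^ B.card * S.card := by positivity
  rw [mul_assoc]
  nlinarith [mul_le_mul_of_nonneg_right h1 h3, mul_le_mul_of_nonneg_left hq h2]

open MeasureTheory unitInterval in
/-- Chernoff bound for the upper tail, with the exponential base `e`. -/
lemma binomialRandom_real_le_card_starSet {V : Type*} [Fintype V] [DecidableEq V] (p : I)
    {A B S : Finset V} (hAB : Disjoint A B) (hAS : Disjoint A S) (hBS : Disjoint B S) {x q : ℝ}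
    (hq : (p : ℝ) ^ A.card * (1 - p) ^ B.card * S.card ≤ q) :
    (binomialRandom V p).real {G | x ≤ ((starSet G A B S).card : ℝ)} ≤ Real.exp (2 * q - x) := by
  have h := binomialRandom_real_le_pow_card_starSet p hAB hAS hBS (Real.exp_pos 1).le
    (Real.exp_pos x)
  have hsub : {G : SimpleGraph V | x ≤ ((starSet G A B S).card : ℝ)} ⊆
      {G | Real.exp x ≤ Real.exp 1 ^ (starSet G A B S).card} := by
    intro G hG
    rw [Set.mem_ofPred_eq] at hG ⊢
    rw [← Real.exp_nat_mul, mul_one]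
    exact Real.exp_le_exp.2 hG
  refine (measureReal_mono hsub).trans (h.trans ?_)
  rw [← Real.exp_neg, ← Real.exp_add]
  refine Real.exp_le_exp.2 ?_
  have hp0 : (0 : ℝ) ≤ p := p.2.1
  have hp1 : (0 : ℝ) ≤ 1 - p := sub_nonneg.2 p.2.2
  have h1 := Real.exp_one_lt_d9
  have h3 : (0 : ℝ) ≤ (p : ℝ) ^ A.card * (1 - p) ^ B.card * S.card := by positivity
  rw [mul_assoc]
  nlinarith

/-! ### Asymptotically almost sure events -/

open MeasureTheory in
lemma aas_of_real_le {p : ℕ → unitInterval} {P : ∀ n : ℕ, SimpleGraph (Fin n) → Prop}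
    {b : ℕ → ℝ} (hb : Tendsto b atTop (𝓝 0))
    (h : ∀ᶠ n in atTop, (binomialRandom (Fin n) (p n)).real {G | ¬ P n G} ≤ b n) : Aas p P := by
  have h0 : Tendsto (fun n => (binomialRandom (Fin n) (p n)).real {G | ¬ P n G}) atTop (𝓝 0) :=
    squeeze_zero' (.of_forall fun n => measureReal_nonneg) h hb
  rw [Aas, ← ENNReal.tendsto_toReal_iff (fun n => measure_ne_top _ _) ENNReal.one_ne_top]
  have h1 := h0.const_sub 1
  rw [sub_zero] at h1
  refine h1.congr fun n => ?_
  have h2 := probReal_compl_eq_one_sub (μ := binomialRandom (Fin n) (p n))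
    (s := {G | ¬ P n G}) (Set.toFinite _).measurableSet
  rw [← h2, ← measureReal_def]
  congr 1
  ext G
  simp

open MeasureTheory in
lemma Aas.mono {p : ℕ → unitInterval} {P Q : ∀ n : ℕ, SimpleGraph (Fin n) → Prop}
    (hP : Aas p P) (h : ∀ᶠ n in atTop, ∀ G, P n G → Q n G) : Aas p Q :=
  tendsto_of_tendsto_of_tendsto_of_le_of_le' hP tendsto_const_nhds
    (h.mono fun _ hn => measure_mono fun G hG => hn G hG) (.of_forall fun _ => prob_le_one)

open MeasureTheory in
lemma Aas.tendsto_real_not {p : ℕ → unitInterval} {P : ∀ n : ℕ, SimpleGraph (Fin n) → Prop}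
    (hP : Aas p P) :
    Tendsto (fun n => (binomialRandom (Fin n) (p n)).real {G | ¬ P n G}) atTop (𝓝 0) := by
  rw [Aas, ← ENNReal.tendsto_toReal_iff (fun n => measure_ne_top _ _) ENNReal.one_ne_top] at hP
  have h1 := hP.const_sub 1
  rw [ENNReal.toReal_one, sub_self] at h1
  refine h1.congr fun n => ?_
  have h2 := probReal_compl_eq_one_sub (μ := binomialRandom (Fin n) (p n))
    (s := {G | P n G}) (Set.toFinite _).measurableSet
  rw [← measureReal_def, ← h2]
  rfl

open MeasureTheory in
lemma Aas.and {p : ℕ → unitInterval} {P Q : ∀ n : ℕ, SimpleGraph (Fin n) → Prop}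
    (hP : Aas p P) (hQ : Aas p Q) : Aas p (fun n G => P n G ∧ Q n G) := by
  have h := hP.tendsto_real_not.add hQ.tendsto_real_not
  rw [add_zero] at h
  refine aas_of_real_le h (.of_forall fun n => ?_)
  refine (measureReal_mono ?_).trans (measureReal_union_le _ _)
  intro G hG
  exact not_and_or.1 hG

open MeasureTheory in
lemma binomialRandom_real_exists_le {V ι : Type*} [Finite V] (p : unitInterval) (s : Finset ι)
    (P : ι → SimpleGraph V → Prop) {b : ℝ}
    (h : ∀ i ∈ s, (binomialRandom V p).real {G | P i G} ≤ b) :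
    (binomialRandom V p).real {G | ∃ i ∈ s, P i G} ≤ s.card * b := by
  have hset : {G | ∃ i ∈ s, P i G} = ⋃ i ∈ s, {G | P i G} := by
    ext G; simp
  rw [hset, ← nsmul_eq_mul, ← Finset.sum_const]
  exact (measureReal_biUnion_finset_le s _).trans (Finset.sum_le_sum h)

/-- Diagonalisation: properties that are monotone in `ε` and hold asymptotically almost surely for
each fixed `ε > 0` also hold along some sequence `δ n → 0`. The sequence is, up to `1 / (n + 1)`,
the infimum of the `ε` whose property has probability at least `1 - ε`. -/
lemma exists_tendsto_zero_aas {p : ℕ → unitInterval} {P : ℝ → ∀ n : ℕ, SimpleGraph (Fin n) → Prop}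
    (hmono : ∀ ε ε' n G, ε ≤ ε' → P ε n G → P ε' n G) (h : ∀ ε, 0 < ε → Aas p (P ε)) :
    ∃ δ : ℕ → ℝ, Tendsto δ atTop (𝓝 0) ∧ Aas p fun n => P (δ n) n := by
  let S : ℕ → Set ℝ := fun n =>
    {ε | 0 < ε ∧ (binomialRandom (Fin n) (p n)).real {G | ¬ P ε n G} ≤ ε}
  have hbdd : ∀ n, BddBelow (S n) := fun n => ⟨0, fun x hx => hx.1.le⟩
  have hne : ∀ n, (S n).Nonempty := fun n => ⟨1, one_pos, MeasureTheory.measureReal_le_one⟩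
  have hδ : Tendsto (fun n : ℕ => sInf (S n) + 1 / ((n : ℝ) + 1)) atTop (𝓝 0) := by
    have h0 : Tendsto (fun n => sInf (S n)) atTop (𝓝 0) := by
      refine tendsto_order.2 ⟨fun a ha => .of_forall fun n =>
        ha.trans_le (le_csInf (hne n) fun x hx => hx.1.le), fun a ha => ?_⟩
      filter_upwards [(h (a / 2) (half_pos ha)).tendsto_real_not.eventually_le_const
        (half_pos ha)] with n hn
      exact (csInf_le (hbdd n) ⟨half_pos ha, hn⟩).trans_lt (half_lt_self ha)
    simpa using h0.add tendsto_one_div_add_atTop_nhds_zero_nat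
  refine ⟨_, hδ, aas_of_real_le hδ (.of_forall fun n => ?_)⟩
  have hlt : sInf (S n) < sInf (S n) + 1 / ((n : ℝ) + 1) :=
    lt_add_of_pos_right _ Nat.one_div_pos_of_nat
  obtain ⟨ε, hε, hεlt⟩ := exists_lt_of_csInf_lt (hne n) hlt
  exact (MeasureTheory.measureReal_mono (fun G hG => by
    exact fun hP => hG (hmono _ _ n G hεlt.le hP))).trans (hε.2.trans hεlt.le)

/-! ### Typical properties of the random graph -/

lemma tendsto_natCast_rpow_atTop {γ : ℝ} (hγ : 0 < γ) :
    Tendsto (fun n : ℕ => (n : ℝ) ^ γ) atTop atTop :=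
  (tendsto_rpow_atTop hγ).comp tendsto_natCast_atTop_atTop

/-- A stretched exponential beats a union bound over pairs of vertices. -/
lemma tendsto_sq_mul_exp_neg_rpow {c γ : ℝ} (hc : 0 < c) (hγ : 0 < γ) :
    Tendsto (fun n : ℕ => (n : ℝ) ^ 2 * Real.exp (-c * (n : ℝ) ^ γ)) atTop (𝓝 0) := by
  have h := (tendsto_rpow_mul_exp_neg_mul_atTop_nhds_zero (2 / γ) c hc).comp
    (tendsto_natCast_rpow_atTop hγ)
  refine h.congr fun n => ?_
  simp only [Function.comp]
  rw [← Real.rpow_mul (Nat.cast_nonneg n), mul_div_cancel₀ _ hγ.ne', Real.rpow_two]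

section

variable {α : ℝ} {p : ℕ → unitInterval}

lemma prob_eq_rpow_neg (hp : ∀ n : ℕ, 1 ≤ n → (p n : ℝ) = 1 / (n : ℝ) ^ α) {n : ℕ} (hn : 1 ≤ n) :
    (p n : ℝ) = (n : ℝ) ^ (-α) := by
  rw [hp n hn, Real.rpow_neg (Nat.cast_nonneg n), one_div]

lemma prob_mul_eq (hp : ∀ n : ℕ, 1 ≤ n → (p n : ℝ) = 1 / (n : ℝ) ^ α) {n : ℕ} (hn : 1 ≤ n) :
    (p n : ℝ) * n = (n : ℝ) ^ (1 - α) := by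
  rw [prob_eq_rpow_neg hp hn, ← Real.rpow_add_one (by positivity), neg_add_eq_sub]

lemma tendsto_prob (hα : 0 < α) (hp : ∀ n : ℕ, 1 ≤ n → (p n : ℝ) = 1 / (n : ℝ) ^ α) :
    Tendsto (fun n => (p n : ℝ)) atTop (𝓝 0) := by
  refine ((tendsto_rpow_neg_atTop hα).comp tendsto_natCast_atTop_atTop).congr' ?_
  filter_upwards [eventually_ge_atTop 1] with n hn
  exact (prob_eq_rpow_neg hp hn).symm

/-- The private neighbourhoods of `x` and `y` each have size `(1 - o(1)) p n`, so that
`(2 - o(1)) p n` vertices distinguish them. -/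
lemma aas_private_neighbors (hα₀ : 0 < α) (hα₁ : α < 1)
    (hp : ∀ n : ℕ, 1 ≤ n → (p n : ℝ) = 1 / (n : ℝ) ^ α) {η : ℝ} (hη₀ : 0 < η) (hη₁ : η < 1) :
    Aas p fun n G => ∀ x y, x ≠ y →
      (1 - η) * (p n * n) ≤ (starSet G {x} {y} {x, y}ᶜ).card := by
  have h2 : Tendsto (fun n : ℕ => (n : ℝ)) atTop atTop := tendsto_natCast_atTop_atTop
  refine aas_of_real_le (tendsto_sq_mul_exp_neg_rpow (c := η ^ 2 / 8) (γ := 1 - α)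
    (by positivity) (by linarith)) ?_
  filter_upwards [eventually_ge_atTop 2, (tendsto_prob hα₀ hp).eventually_le_const
    (show 0 < η / 8 by positivity), h2.eventually_ge_atTop (16 / η)] with n hn hpn hnη
  rw [div_le_iff₀ hη₀] at hnη
  have hp0 : (0 : ℝ) ≤ p n := (p n).2.1
  have hn0 : (0 : ℝ) ≤ n := Nat.cast_nonneg n
  set N : ℝ := p n * n with hN
  have hN0 : 0 ≤ N := by positivity
  have hbound := binomialRandom_real_exists_le (p n) (Finset.univ : Finset (Fin n × Fin n))
    (fun z G => z.1 ≠ z.2 ∧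
      ((starSet G {z.1} {z.2} {z.1, z.2}ᶜ).card : ℝ) ≤ (1 - η) * N)
    (b := Real.exp (-(η ^ 2 / 8) * (n : ℝ) ^ (1 - α))) ?_
  · refine (MeasureTheory.measureReal_mono ?_).trans (hbound.trans (le_of_eq ?_))
    · intro G hG
      simp only [Set.mem_ofPred_eq, not_forall, not_le] at hG ⊢
      obtain ⟨x, y, hxy, h⟩ := hG
      exact ⟨(x, y), Finset.mem_univ _, hxy, h.le⟩
    · simp [sq]
  · rintro ⟨x, y⟩ -
    by_cases hxy : x = y
    · simp [hxy, Real.exp_nonneg]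
    simp only [ne_eq, hxy, not_false_eq_true, true_and]
    have hcard : ((({x, y} : Finset (Fin n))ᶜ).card : ℝ) = n - 2 := by
      rw [Finset.card_compl, Finset.card_pair hxy, Fintype.card_fin, Nat.cast_sub hn]; simp
    refine (binomialRandom_real_card_starSet_le (p n) (s := η / 4) (q := (1 - η / 4) * N)
      (by simpa using hxy) (by simp) (by simp) (by positivity) ?_).trans ?_
    · rw [hcard, Finset.card_singleton, Finset.card_singleton, pow_one, pow_one, hN]
      have : (1 - η / 4) * n ≤ (1 - p n) * (n - 2) := by nlinarith
      nlinarith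
    · refine Real.exp_le_exp.2 ?_
      rw [← prob_mul_eq hp (by omega), ← hN]
      have h1 : η / 4 * (1 - η / 4) ≤ η / 4 / (1 + η / 4) := by
        rw [le_div_iff₀ (by positivity)]
        nlinarith [pow_pos hη₀ 3]
      have h3 : η / 4 * (1 - η / 4) * ((1 - η / 4) * N) ≤
          η / 4 / (1 + η / 4) * ((1 - η / 4) * N) :=
        mul_le_mul_of_nonneg_right h1 (mul_nonneg (by linarith) hN0)
      have h4 : 0 ≤ η ^ 3 * N := by positivity
      nlinarith

lemma aas_degree_le (hα₁ : α < 1)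
    (hp : ∀ n : ℕ, 1 ≤ n → (p n : ℝ) = 1 / (n : ℝ) ^ α) :
    Aas p fun n G => ∀ v, ((starSet G {v} ∅ {v}ᶜ).card : ℝ) ≤ 3 * (p n * n) := by
  refine aas_of_real_le (tendsto_sq_mul_exp_neg_rpow (c := 1) (γ := 1 - α)
    one_pos (by linarith)) ?_
  filter_upwards [eventually_ge_atTop 1] with n hn
  have hp0 : (0 : ℝ) ≤ p n := (p n).2.1
  have hn1 : (1 : ℝ) ≤ n := by exact_mod_cast hn
  have hbound := binomialRandom_real_exists_le (p n) (Finset.univ : Finset (Fin n))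
    (fun v G => 3 * ((p n : ℝ) * n) ≤ ((starSet G {v} ∅ {v}ᶜ).card : ℝ))
    (b := Real.exp (-1 * (n : ℝ) ^ (1 - α))) ?_
  · refine (MeasureTheory.measureReal_mono ?_).trans (hbound.trans ?_)
    · intro G hG
      simp only [Set.mem_ofPred_eq, not_forall, not_le] at hG ⊢
      obtain ⟨v, h⟩ := hG
      exact ⟨v, Finset.mem_univ _, h.le⟩
    · rw [Finset.card_univ, Fintype.card_fin]
      gcongr
      nlinarith
  · intro v _
    refine (binomialRandom_real_le_card_starSet (p n) (q := (p n : ℝ) * n)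
      (by simp) (by simp) (by simp) ?_).trans (Real.exp_le_exp.2 ?_)
    · rw [Finset.card_singleton, Finset.card_empty, pow_one, pow_zero, mul_one]
      gcongr
      exact (Finset.card_le_univ _).trans (by simp)
    · rw [← prob_mul_eq hp hn]
      linarith

lemma aas_exists_common_neighbor (hα₁ : α < 1 / 2)
    (hp : ∀ n : ℕ, 1 ≤ n → (p n : ℝ) = 1 / (n : ℝ) ^ α) :
    Aas p fun _ G => ∀ x y, x ≠ y → ∃ z, G.Adj z x ∧ G.Adj z y := by
  refine aas_of_real_le (tendsto_sq_mul_exp_neg_rpow (c := 1 / 4) (γ := 1 - 2 * α)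
    (by norm_num) (by linarith)) ?_
  filter_upwards [eventually_ge_atTop 4] with n hn
  have hn0 : (4 : ℝ) ≤ n := by exact_mod_cast hn
  have hbound := binomialRandom_real_exists_le (p n) (Finset.univ : Finset (Fin n × Fin n))
    (fun z G => z.1 ≠ z.2 ∧
      ((starSet G {z.1, z.2} ∅ {z.1, z.2}ᶜ).card : ℝ) ≤ 0)
    (b := Real.exp (-(1 / 4) * (n : ℝ) ^ (1 - 2 * α))) ?_
  · refine (MeasureTheory.measureReal_mono ?_).trans (hbound.trans (le_of_eq ?_))
    · intro G hG
      simp only [Set.mem_ofPred_eq, not_forall] at hG ⊢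
      obtain ⟨x, y, hxy, h⟩ := hG
      refine ⟨(x, y), Finset.mem_univ _, hxy, ?_⟩
      by_contra! hpos
      obtain ⟨z, hz⟩ := Finset.card_pos.1 (Nat.cast_pos.1 hpos)
      have := (mem_starSet.1 hz).2.1
      exact h ⟨z, this x (by simp), this y (by simp)⟩
    · simp [sq]
  · rintro ⟨x, y⟩ -
    by_cases hxy : x = y
    · simp [hxy, Real.exp_nonneg]
    simp only [ne_eq, hxy, not_false_eq_true, true_and]
    have hcard : ((({x, y} : Finset (Fin n))ᶜ).card : ℝ) = n - 2 := by
      rw [Finset.card_compl, Finset.card_pair hxy, Fintype.card_fin, Nat.cast_sub (by omega)]; simp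
    have hpn : (p n : ℝ) ^ 2 * n = (n : ℝ) ^ (1 - 2 * α) := by
      rw [prob_eq_rpow_neg hp (by omega), ← Real.rpow_natCast, ← Real.rpow_mul (by positivity),
        ← Real.rpow_add_one (by positivity)]
      congr 1
      push_cast
      ring
    refine (binomialRandom_real_card_starSet_le (p n) (s := 1) (q := (p n : ℝ) ^ 2 * n / 2)
      (by simp) disjoint_compl_right (by simp) zero_le_one ?_).trans (Real.exp_le_exp.2 ?_)
    · rw [hcard, Finset.card_empty, Finset.card_pair hxy, pow_zero, mul_one]
      nlinarith [sq_nonneg (p n : ℝ)]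
    · rw [← hpn]
      apply le_of_eq
      ring

/-- If `k n ≤ θ n ^ α log n` with `θ < 1 - 2 α`, then for every query set `W` of size `k n` every
vertex `v` has about `n ^ (1 - α) (1 - p) ^ k ≥ n ^ β` neighbours avoiding `W` and its
neighbourhood, for some `β > α`. This survives the union bound, because there are only
`exp (O(n ^ α (log n) ^ 2))` query sets. -/
lemma aas_escape (hα₀ : 0 < α) (hα₁ : α < 1 / 2)
    (hp : ∀ n : ℕ, 1 ≤ n → (p n : ℝ) = 1 / (n : ℝ) ^ α) {θ : ℝ} (hθ₀ : 0 < θ)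
    (hθ₁ : θ < 1 - 2 * α) {k : ℕ → ℕ}
    (hk : ∀ᶠ n : ℕ in atTop, (k n : ℝ) ≤ θ * (n : ℝ) ^ α * Real.log n) :
    Aas p fun n G => ∀ (W : Finset (Fin n)) (v : Fin n), W.card = k n →
      1 < (starSet G {v} (W.erase v) (insert v W)ᶜ).card := by
  set θ' := (θ + (1 - 2 * α)) / 2 with hθ'
  set β := 1 - α - θ' with hβ
  have hβα : 0 < β - α := by rw [hβ, hθ']; linarith
  have hβ0 : 0 < β := by linarith
  have hlog : Tendsto (fun n : ℕ => Real.log n) atTop atTop :=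
    Real.tendsto_log_atTop.comp tendsto_natCast_atTop_atTop
  have hlog2 : ∀ᶠ n : ℕ in atTop, 2 * (Real.log n) ^ 2 ≤ (n : ℝ) ^ (β - α) / 8 := by
    have := (isLittleO_log_rpow_rpow_atTop 2 hβα).comp_tendsto
      (tendsto_natCast_atTop_atTop (R := ℝ))
    filter_upwards [this.bound (show (0 : ℝ) < 1 / 16 by norm_num)] with n hn
    simp only [Function.comp, Real.norm_eq_abs, Real.rpow_two] at hn
    rw [abs_of_nonneg (sq_nonneg (Real.log (n : ℝ))),
      abs_of_nonneg (Real.rpow_nonneg (Nat.cast_nonneg n) _)] at hn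
    linarith
  have hlog1 : ∀ᶠ n : ℕ in atTop, Real.log n ≤ (n : ℝ) ^ (1 - α) / 4 := by
    have := (isLittleO_log_rpow_atTop (show 0 < 1 - α by linarith)).comp_tendsto
      (tendsto_natCast_atTop_atTop (R := ℝ))
    filter_upwards [this.bound (show (0 : ℝ) < 1 / 4 by norm_num)] with n hn
    simp only [Function.comp, Real.norm_eq_abs] at hn
    rw [abs_of_nonneg (Real.rpow_nonneg (Nat.cast_nonneg n) _)] at hn
    linarith [le_abs_self (Real.log n)]
  have hlim : Tendsto (fun n : ℕ => Real.exp (1 - (n : ℝ) ^ β / 8)) atTop (𝓝 0) :=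
    Real.tendsto_exp_atBot.comp (tendsto_atBot_add_const_left _ 1
      (tendsto_neg_atTop_atBot.comp
        ((tendsto_natCast_rpow_atTop hβ0).atTop_div_const (by norm_num))))
  refine aas_of_real_le hlim ?_
  filter_upwards [eventually_ge_atTop 4, hk, hlog2, hlog1, hlog.eventually_ge_atTop 1,
    (tendsto_prob hα₀ hp).eventually_le_const (show 0 < 1 - θ / θ' by
      rw [sub_pos, div_lt_one (by rw [hθ']; linarith), hθ']; linarith)]
    with n hn hkn hl2 hl1 hL hpn
  set L := Real.log n with hLdef
  have hn4 : (4 : ℝ) ≤ n := by exact_mod_cast hn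
  have hnpos : (0 : ℝ) < n := by linarith
  have hp0 : (0 : ℝ) ≤ p n := (p n).2.1
  have hθ'0 : 0 < θ' := by rw [hθ']; linarith
  have h1p : 0 < 1 - (p n : ℝ) := by
    have : 0 < θ / θ' := by positivity
    linarith
  have hpα : (p n : ℝ) * (n : ℝ) ^ α = 1 := by
    rw [hp n (by omega)]; field_simp
  have hnα : 1 ≤ (n : ℝ) ^ α := Real.one_le_rpow (by linarith) hα₀.le
  -- A query set occupies at most half of the vertices.
  have hk2 : (k n : ℝ) + 1 ≤ n / 2 := by
    have h1 : (n : ℝ) ^ α * (n : ℝ) ^ (1 - α) = n := by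
      rw [← Real.rpow_add hnpos]; simp
    have h2 : (k n : ℝ) ≤ (n : ℝ) ^ α * L := by
      refine hkn.trans (mul_le_mul_of_nonneg_right ?_ (by linarith))
      nlinarith
    have h3 : (n : ℝ) ^ α * L ≤ (n : ℝ) ^ α * ((n : ℝ) ^ (1 - α) / 4) := by gcongr
    nlinarith
  -- `(1 - p) ^ k ≥ exp (- p k / (1 - p)) ≥ n ^ (-θ')`
  have hpow : (n : ℝ) ^ (-θ') ≤ (1 - p n : ℝ) ^ k n := by
    have h1 : 1 - (1 - (p n : ℝ))⁻¹ ≤ Real.log (1 - p n) := Real.one_sub_inv_le_log_of_pos h1p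
    have h2 : (p n : ℝ) * k n ≤ θ * L := by
      calc (p n : ℝ) * k n ≤ p n * (θ * (n : ℝ) ^ α * L) := by gcongr
        _ = (p n * (n : ℝ) ^ α) * (θ * L) := by ring
        _ = θ * L := by rw [hpα, one_mul]
    have h3 : θ ≤ θ' * (1 - p n) := by
      have : θ / θ' ≤ 1 - p n := by linarith
      rwa [div_le_iff₀' hθ'0] at this
    rw [Real.rpow_def_of_pos hnpos, ← Real.exp_log h1p, ← Real.exp_nat_mul]
    refine Real.exp_le_exp.2 ?_
    have h4 : 1 - (1 - (p n : ℝ))⁻¹ = - (p n / (1 - p n)) := by field_simp; ring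
    have h5 : (k n : ℝ) * (p n / (1 - p n)) ≤ θ' * L := by
      rw [← mul_div_assoc, div_le_iff₀ h1p]
      nlinarith
    have h6 : (k n : ℝ) * (1 - (1 - (p n : ℝ))⁻¹) ≤ k n * Real.log (1 - p n) := by gcongr
    rw [h4] at h6
    rw [← hLdef]
    linarith
  have hbound := binomialRandom_real_exists_le (p n)
    ((Finset.powersetCard (k n) (Finset.univ : Finset (Fin n))) ×ˢ
      (Finset.univ : Finset (Fin n)))
    (fun z G => ((starSet G {z.2} (z.1.erase z.2) (insert z.2 z.1)ᶜ).card : ℝ) ≤ 1)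
    (b := Real.exp (1 - (n : ℝ) ^ β / 4)) ?_
  · refine (MeasureTheory.measureReal_mono ?_).trans (hbound.trans ?_)
    · intro G hG
      simp only [Set.mem_ofPred_eq, not_forall, not_lt] at hG ⊢
      obtain ⟨W, v, hW, h⟩ := hG
      refine ⟨(W, v), ?_, by exact_mod_cast h⟩
      simp [hW]
    · rw [Finset.card_product, Finset.card_powersetCard, Finset.card_univ, Fintype.card_fin]
      have h1 : ((n.choose (k n) * n : ℕ) : ℝ) ≤ Real.exp ((k n + 1) * L) := by
        calc ((n.choose (k n) * n : ℕ) : ℝ) ≤ ((n ^ k n * n : ℕ) : ℝ) := by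
              gcongr; exact Nat.choose_le_pow _ _
          _ = (n : ℝ) ^ (k n + 1) := by push_cast; ring
          _ = Real.exp ((k n + 1) * L) := by
              rw [← Real.exp_log hnpos, ← Real.exp_nat_mul]
              push_cast
              rfl
      refine (mul_le_mul_of_nonneg_right h1 (Real.exp_nonneg _)).trans ?_
      rw [← Real.exp_add]
      refine Real.exp_le_exp.2 ?_
      have h2 : (k n : ℝ) + 1 ≤ 2 * ((n : ℝ) ^ α * L) := by
        have : (k n : ℝ) ≤ (n : ℝ) ^ α * L := by
          refine hkn.trans (mul_le_mul_of_nonneg_right ?_ (by linarith))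
          nlinarith
        nlinarith
      have h3 : ((k n : ℝ) + 1) * L ≤ (n : ℝ) ^ β / 8 := by
        calc ((k n : ℝ) + 1) * L ≤ 2 * ((n : ℝ) ^ α * L) * L := by gcongr
          _ = (n : ℝ) ^ α * (2 * L ^ 2) := by ring
          _ ≤ (n : ℝ) ^ α * ((n : ℝ) ^ (β - α) / 8) := by gcongr
          _ = (n : ℝ) ^ β / 8 := by
              rw [← mul_div_assoc, ← Real.rpow_add hnpos]; congr 2; ring
      linarith
  · rintro ⟨W, v⟩ hW
    simp only [Finset.mem_product, Finset.mem_powersetCard, Finset.subset_univ, true_and,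
      Finset.mem_univ, and_true] at hW
    refine (binomialRandom_real_card_starSet_le (p n) (s := 1) (q := (n : ℝ) ^ β / 2)
      (by simp) (by simp) ?_ zero_le_one ?_).trans (Real.exp_le_exp.2 ?_)
    · exact disjoint_compl_right.mono_left
        ((Finset.erase_subset _ _).trans (Finset.subset_insert _ _))
    · rw [Finset.card_singleton, pow_one]
      have h1 : (n : ℝ) ^ (-θ') ≤ (1 - p n : ℝ) ^ (W.erase v).card :=
        hpow.trans (pow_le_pow_of_le_one h1p.le (by linarith)
          ((Finset.card_erase_le).trans hW.le))
      have h2 : (n : ℝ) / 2 ≤ ((insert v W)ᶜ : Finset (Fin n)).card := by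
        have h3 := Finset.card_add_card_compl (insert v W)
        have h4 := Finset.card_insert_le v W
        rw [Fintype.card_fin] at h3
        rw [hW] at h4
        have h3' : ((insert v W).card : ℝ) + ((insert v W)ᶜ : Finset (Fin n)).card = n := by
          exact_mod_cast h3
        have h4' : ((insert v W).card : ℝ) ≤ k n + 1 := by exact_mod_cast h4
        linarith
      calc (n : ℝ) ^ β / 2 = (p n : ℝ) * (n : ℝ) ^ (-θ') * (n / 2) := by
            rw [mul_right_comm, ← mul_div_assoc, prob_mul_eq hp (by omega), div_mul_eq_mul_div,
              ← Real.rpow_add hnpos, ← sub_eq_add_neg]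
        _ ≤ _ := by gcongr
    · apply le_of_eq
      ring

/-! ### The two bounds for the random graph -/

lemma aas_lower_bound (r : RobberRule) (hα₀ : 0 < α) (hα₁ : α < 1 / 2)
    (hp : ∀ n : ℕ, 1 ≤ n → (p n : ℝ) = 1 / (n : ℝ) ^ α) {ε : ℝ} (hε : 0 < ε) :
    Aas p fun n G => (1 - 2 * α) * (n : ℝ) ^ α * Real.log n
      ≤ (1 + ε) * (localizationNumber G r : ℝ) := by
  set θ := (1 - 2 * α) / (1 + ε) with hθ
  have hθ₀ : 0 < θ := div_pos (by linarith) (by linarith)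
  have hθ₁ : θ < 1 - 2 * α := div_lt_self (by linarith) (by linarith)
  have hk : ∀ n : ℕ, (⌊θ * (n : ℝ) ^ α * Real.log n⌋₊ : ℝ) ≤ θ * (n : ℝ) ^ α * Real.log n :=
    fun n => Nat.floor_le (mul_nonneg (mul_nonneg hθ₀.le (by positivity))
      (Real.log_natCast_nonneg n))
  have hlog1 : ∀ᶠ n : ℕ in atTop, Real.log n ≤ (n : ℝ) ^ (1 - α) := by
    have := (isLittleO_log_rpow_atTop (show 0 < 1 - α by linarith)).comp_tendsto
      (tendsto_natCast_atTop_atTop (R := ℝ))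
    filter_upwards [this.bound one_pos] with n hn
    simp only [Function.comp, Real.norm_eq_abs, one_mul] at hn
    rw [abs_of_nonneg (Real.rpow_nonneg (Nat.cast_nonneg n) _)] at hn
    exact (le_abs_self _).trans hn
  refine ((aas_exists_common_neighbor hα₁ hp).and
    (aas_escape hα₀ hα₁ hp hθ₀ hθ₁ (.of_forall hk))).mono ?_
  filter_upwards [eventually_ge_atTop 1, hlog1] with n hn hl1 G hG
  obtain ⟨hdiam, hesc⟩ := hG
  have : Nonempty (Fin n) := ⟨⟨0, hn⟩⟩
  have hnpos : (0 : ℝ) < n := by exact_mod_cast hn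
  have hkn : ⌊θ * (n : ℝ) ^ α * Real.log n⌋₊ ≤ n := by
    have h1 : (n : ℝ) ^ α * (n : ℝ) ^ (1 - α) = n := by
      rw [← Real.rpow_add hnpos]; simp
    have h2 : θ * (n : ℝ) ^ α * Real.log n ≤ 1 * (n : ℝ) ^ α * (n : ℝ) ^ (1 - α) := by
      gcongr
      linarith
    rw [one_mul, h1] at h2
    exact_mod_cast (hk n).trans h2
  have hlt : ⌊θ * (n : ℝ) ^ α * Real.log n⌋₊ < localizationNumber G r := by
    refine lt_localizationNumber hdiam fun W hW v => ?_
    obtain ⟨W', hWW', -, hW'⟩ := Finset.exists_subsuperset_card_eq (Finset.subset_univ W) hW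
      (by simpa using hkn)
    obtain ⟨u₁, h₁, u₂, h₂, hne⟩ := Finset.one_lt_card.1 (hesc W' v hW')
    have hmem : ∀ u ∈ starSet G {v} (W'.erase v) (insert v W')ᶜ,
        G.Adj u v ∧ u ∉ W ∧ ∀ w ∈ W, w ≠ v → ¬ G.Adj u w := by
      intro u hu
      obtain ⟨h1, h2, h3⟩ := mem_starSet.1 hu
      refine ⟨h2 v (by simp), fun huW => ?_, fun w hw hwv => ?_⟩
      · exact Finset.mem_compl.1 h1 (Finset.mem_insert_of_mem (hWW' huW))
      · exact h3 w (Finset.mem_erase.2 ⟨hwv, hWW' hw⟩)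
    refine ⟨u₁, u₂, hne, ?_⟩
    rintro u (rfl | rfl)
    · exact hmem _ h₁
    · exact hmem _ h₂
  have h1 : θ * (n : ℝ) ^ α * Real.log n ≤ localizationNumber G r := by
    have h2 := (Nat.lt_floor_add_one (θ * (n : ℝ) ^ α * Real.log n)).le
    have h3 : ((⌊θ * (n : ℝ) ^ α * Real.log n⌋₊ : ℝ) + 1) ≤ localizationNumber G r := by
      exact_mod_cast hlt
    exact h2.trans h3
  calc (1 - 2 * α) * (n : ℝ) ^ α * Real.log n
      = (1 + ε) * (θ * (n : ℝ) ^ α * Real.log n) := by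
        rw [hθ]; field_simp
    _ ≤ _ := by gcongr

/-- A vertex adjacent to exactly one of `x` and `y` distinguishes them. -/
lemma card_filter_edist_eq_le {V : Type*} [Fintype V] [DecidableEq V] (G : SimpleGraph V)
    {x y : V} {c : ℝ} (h₁ : c ≤ (starSet G {x} {y} {x, y}ᶜ).card)
    (h₂ : c ≤ (starSet G {y} {x} {y, x}ᶜ).card) :
    ((Finset.univ.filter fun w => G.edist x w = G.edist y w).card : ℝ) ≤
      Fintype.card V - 2 * c := by
  set B := Finset.univ.filter fun w => G.edist x w = G.edist y w
  have hadj : ∀ w ∈ B, G.Adj w x ↔ G.Adj w y := by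
    intro w hw
    rw [G.adj_comm w x, G.adj_comm w y, ← edist_eq_one_iff_adj, ← edist_eq_one_iff_adj,
      (Finset.mem_filter.1 hw).2]
  have hB : Disjoint B (starSet G {x} {y} {x, y}ᶜ ∪ starSet G {y} {x} {y, x}ᶜ) := by
    rw [Finset.disjoint_left]
    intro w hw hw'
    have := hadj w hw
    simp only [Finset.mem_union, mem_starSet, Finset.mem_singleton, forall_eq] at hw'
    tauto
  have hS : Disjoint (starSet G {x} {y} {x, y}ᶜ) (starSet G {y} {x} {y, x}ᶜ) := by
    rw [Finset.disjoint_left]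
    intro w hw hw'
    simp only [mem_starSet, Finset.mem_singleton, forall_eq] at hw hw'
    tauto
  have h := Finset.card_le_univ (B ∪ (starSet G {x} {y} {x, y}ᶜ ∪ starSet G {y} {x} {y, x}ᶜ))
  rw [Finset.card_union_of_disjoint hB, Finset.card_union_of_disjoint hS] at h
  have h' : (B.card : ℝ) + ((starSet G {x} {y} {x, y}ᶜ).card +
      (starSet G {y} {x} {y, x}ᶜ).card) ≤ Fintype.card V := by exact_mod_cast h
  linarith

lemma aas_upper_bound (r : RobberRule) (hα₀ : 0 < α) (hα₁ : α < 1)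
    (hp : ∀ n : ℕ, 1 ≤ n → (p n : ℝ) = 1 / (n : ℝ) ^ α) {ε : ℝ} (hε : 0 < ε) :
    Aas p fun n G => (localizationNumber G r : ℝ)
      ≤ (1 + ε) * ((1 - α) * (n : ℝ) ^ α * Real.log n) := by
  classical
  -- With this choice `(1 - η) (1 + ε) = 1 + ε / 2`.
  set η := ε / (2 * (1 + ε)) with hη
  have hη₀ : 0 < η := by positivity
  have hη₁ : η < 1 := by rw [hη, div_lt_one (by positivity)]; linarith
  have hηε : (1 - η) * (1 + ε) = 1 + ε / 2 := by rw [hη]; field_simp; ring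
  have hlog : Tendsto (fun n : ℕ => Real.log n) atTop atTop :=
    Real.tendsto_log_atTop.comp tendsto_natCast_atTop_atTop
  have hfin : ∀ᶠ n : ℕ in atTop, 2 + Real.log 32 < ε * (1 - α) * Real.log n :=
    (hlog.const_mul_atTop (mul_pos hε (by linarith))).eventually_gt_atTop _
  refine ((aas_private_neighbors hα₀ hα₁ hp hη₀ hη₁).and (aas_degree_le hα₁ hp)).mono ?_
  filter_upwards [eventually_ge_atTop 1, hfin,
    (tendsto_prob hα₀ hp).eventually_le_const (show (0 : ℝ) < 1 / 2 by norm_num)]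
    with n hn hfin hpn G hG
  obtain ⟨hpriv, hdeg⟩ := hG
  have : Nonempty (Fin n) := ⟨⟨0, hn⟩⟩
  have hnpos : (0 : ℝ) < n := by exact_mod_cast hn
  have hn1 : (1 : ℝ) ≤ n := by exact_mod_cast hn
  have hp0 : (0 : ℝ) ≤ p n := (p n).2.1
  set L := Real.log n with hL
  have hL0 : 0 ≤ L := Real.log_natCast_nonneg n
  have hpα : (p n : ℝ) * (n : ℝ) ^ α = 1 := by
    rw [hp n hn]; field_simp
  set K : ℝ := (1 + ε) * ((1 - α) * (n : ℝ) ^ α * L) with hK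
  have hK0 : 0 ≤ K := by
    have : 0 ≤ 1 - α := by linarith
    positivity
  set ρ : ℝ := 1 - 2 * (1 - η) * p n with hρ
  have hρ0 : 0 ≤ ρ := by rw [hρ]; nlinarith
  have hpn1 : (1 : ℝ) ≤ p n * n := by
    rw [prob_mul_eq hp hn]
    exact Real.one_le_rpow hn1 (by linarith)
  suffices h : localizationNumber G r ≤ ⌊K⌋₊ from
    (Nat.cast_le.2 h).trans (Nat.floor_le hK0)
  refine localizationNumber_le (Δ := ⌊3 * ((p n : ℝ) * n)⌋₊) hρ0 (fun v => ?_)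
    (fun x y hxy => ?_) ?_
  · refine Nat.le_floor ((le_of_eq ?_).trans (hdeg v))
    rw [← card_neighborFinset_eq_degree]
    congr 2
    ext u
    simp only [mem_neighborFinset, mem_starSet, Finset.mem_compl, Finset.mem_singleton, forall_eq,
      Finset.notMem_empty, false_implies, implies_true, and_true, G.adj_comm u v]
    exact ⟨fun h => ⟨h.ne', h⟩, fun h => h.2⟩
  · refine (card_filter_edist_eq_le G (hpriv x y hxy) (hpriv y x hxy.symm)).trans (le_of_eq ?_)
    rw [Fintype.card_fin, hρ]
    ring
  · have hΔ : (⌊3 * ((p n : ℝ) * n)⌋₊ : ℝ) + 1 ≤ 4 * Real.exp ((1 - α) * L) := by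
      have h1 : (⌊3 * ((p n : ℝ) * n)⌋₊ : ℝ) ≤ 3 * (p n * n) := Nat.floor_le (by positivity)
      rw [mul_comm (1 - α), hL, ← Real.rpow_def_of_pos hnpos, ← prob_mul_eq hp hn]
      linarith
    have hfloor : (1 + ε) * (1 - α) * L - 1 ≤ p n * ⌊K⌋₊ := by
      have h1 : K - 1 ≤ ⌊K⌋₊ := (Nat.sub_one_lt_floor K).le
      have h2 : (p n : ℝ) * K = (1 + ε) * (1 - α) * L := by
        calc (p n : ℝ) * K = (1 + ε) * (1 - α) * L * (p n * (n : ℝ) ^ α) := by rw [hK]; ring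
          _ = _ := by rw [hpα, mul_one]
      nlinarith [mul_le_mul_of_nonneg_left h1 hp0]
    have hρk : ρ ^ ⌊K⌋₊ ≤ Real.exp (2 - 2 * (1 + ε / 2) * (1 - α) * L) := by
      calc ρ ^ ⌊K⌋₊ ≤ Real.exp (-(2 * (1 - η) * p n)) ^ ⌊K⌋₊ := by
            refine pow_le_pow_left₀ hρ0 ?_ _
            rw [hρ]
            linarith [Real.add_one_le_exp (-(2 * (1 - η) * (p n : ℝ)))]
        _ = Real.exp (-(2 * (1 - η)) * (p n * ⌊K⌋₊)) := by
            rw [← Real.exp_nat_mul]; congr 1; ring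
        _ ≤ _ := by
            refine Real.exp_le_exp.2 ?_
            rw [← hηε]
            nlinarith [mul_le_mul_of_nonneg_left hfloor (show 0 ≤ 2 * (1 - η) by linarith)]
    calc 2 * ρ ^ ⌊K⌋₊ * ((⌊3 * ((p n : ℝ) * n)⌋₊ : ℝ) + 1) ^ 2
        ≤ 2 * Real.exp (2 - 2 * (1 + ε / 2) * (1 - α) * L) * (4 * Real.exp ((1 - α) * L)) ^ 2 := by
          gcongr
      _ = Real.exp (2 + Real.log 32 - ε * (1 - α) * L) := by
          rw [mul_pow, ← Real.exp_nat_mul, Real.exp_sub (2 + Real.log 32), Real.exp_add,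
            Real.exp_log (by norm_num), Real.exp_sub]
          have : Real.exp (2 * (1 + ε / 2) * (1 - α) * L) =
              Real.exp ((2 : ℕ) * ((1 - α) * L)) * Real.exp (ε * (1 - α) * L) := by
            rw [← Real.exp_add]; congr 1; push_cast; ring
          rw [this]
          field_simp
          norm_num
      _ < 1 := by
          refine (Real.exp_lt_exp.2 ?_).trans_eq Real.exp_zero
          linarith

end

end LocalizationGame

theorem mainTheorem2 (r : LocalizationGame.RobberRule) (α : ℝ) (hα₀ : 0 < α) (hα₁ : α < 1 / 2)
    (p : ℕ → unitInterval) (hp : ∀ n : ℕ, 1 ≤ n → (p n : ℝ) = 1 / (n : ℝ) ^ α) :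
    ∃ δ : ℕ → ℝ, Tendsto δ atTop (𝓝 0) ∧
      LocalizationGame.Aas p fun n G =>
        (1 - 2 * α) * (n : ℝ) ^ α * Real.log n
            ≤ (1 + δ n) * (LocalizationGame.localizationNumber G r : ℝ) ∧
          (LocalizationGame.localizationNumber G r : ℝ)
            ≤ (1 + δ n) *
              ((if α < 1 / 3 then 1 - α else (1 + α) / 2) * (n : ℝ) ^ α * Real.log n) := by
  have hc : 1 - α ≤ if α < 1 / 3 then 1 - α else (1 + α) / 2 := by
    split_ifs <;> linarith
  have hU : ∀ n : ℕ, (1 - α) * (n : ℝ) ^ α * Real.log n ≤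
      (if α < 1 / 3 then 1 - α else (1 + α) / 2) * (n : ℝ) ^ α * Real.log n := fun n =>
    mul_le_mul_of_nonneg_right (mul_le_mul_of_nonneg_right hc (by positivity))
      (Real.log_natCast_nonneg n)
  have hU0 : ∀ n : ℕ, 0 ≤ (1 - α) * (n : ℝ) ^ α * Real.log n := fun n =>
    mul_nonneg (mul_nonneg (by linarith) (by positivity)) (Real.log_natCast_nonneg n)
  refine LocalizationGame.exists_tendsto_zero_aas (P := fun ε n G =>
    (1 - 2 * α) * (n : ℝ) ^ α * Real.log n
        ≤ (1 + ε) * (LocalizationGame.localizationNumber G r : ℝ) ∧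
      (LocalizationGame.localizationNumber G r : ℝ) ≤ (1 + ε) *
        ((if α < 1 / 3 then 1 - α else (1 + α) / 2) * (n : ℝ) ^ α * Real.log n)) ?_ ?_
  · rintro ε ε' n G hεε' ⟨h1, h2⟩
    refine ⟨h1.trans ?_, h2.trans ?_⟩
    · gcongr
    · exact mul_le_mul_of_nonneg_right (by linarith) ((hU0 n).trans (hU n))
  · intro ε hε
    refine ((LocalizationGame.aas_lower_bound r hα₀ hα₁ hp hε).and
      (LocalizationGame.aas_upper_bound r hα₀ (by linarith) hp hε)).mono
      (.of_forall fun n G hG => ⟨hG.1, hG.2.trans ?_⟩)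
    exact mul_le_mul_of_nonneg_left (hU n) (by linarith)
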